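/- Let $\Bbbk=\mathbb{R}$ or $\mathbb{C}$, and let $\langle x,y\rangle = x^{*}y$ on $\Bbbk^d$ with its Euclidean norm. For $A=(a_{ij})\in\Bbbk^{n\times n}$ put $$\|A\|_\gamma=\max_{\|x_i\|=1}\Bigl|\sum_{i,j=1}^n a_{ij}\langle x_i,x_j\rangle\Bigr|,\qquad \|A\|_\Gamma=\max_{\|x_i\|\le 1}\Bigl|\sum_{i,j=1}^n a_{ij}\langle x_i,x_j\rangle\Bigr|,\qquad \|A\|_{\mathsf G}=\max_{\|x_i\|\le 1,\ \|y_j\|\le 1}\Bigl|\sum_{i,j=1}^n a_{ij}\langle x_i,y_j\rangle\Bigr|,$$ with $x_1,\dots,x_n\in\Bbbk^n$ in the first two and $x_1,\dots,x_n,y_1,\dots,y_n\in\Bbbk^{2n}$ in the third, and $$\|A\|_\theta=\max_{|\delta_i|=1}\Bigl|\sum_{i,j=1}^n a_{ij}\bar\delta_i\delta_j\Bigr|,\qquad \|A\|_\Theta=\max_{|\delta_i|\le 1}\Bigl|\sum_{i,j=1}^n a_{ij}\bar\delta_i\delta_j\Bigr|,\qquad \|A\|_{\infty,1}=\max_{|\varepsilon_i|\le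 1,\ |\delta_j|\le 1}\Bigl|\sum_{i,j=1}^n a_{ij}\bar\varepsilon_i\delta_j\Bigr|,$$ with $\delta_i,\varepsilon_i\in\Bbbk$. A superscript $\mathbb{R}$ or $\mathbb{C}$ indicates the field $\Bbbk$. **Theorem 5.1.** For every $n$ and every real symmetric positive semidefinite $n\times n$ matrix $A$, $$\|A\|_\gamma^{\mathbb{R}}\le\frac{\pi}{2}\,\|A\|_\theta^{\mathbb{R}},$$ and for every $n$ and every complex Hermitian positive semidefinite $n\times n$ matrix $A$, $$\|A\|_\gamma^{\mathbb{C}}\le\frac{4}{\pi}\,\|A\|_\theta^{\mathbb{C}}.$$ Both inequalities are sharp: the supremum of $\|A\|_\gamma/\|A\|_\theta$ over all $n$ and all positive semidefinite $n\times n$ matrices $A$ over $\Bbbk$ with $\|A\|_\theta\ne 0$ is exactly $\pi/2$ for $\Bbbk=\mathbb{R}$ and exactly $4/\pi$ for $\Bbbk=\mathbb{C}$. All of this remains true when $\|\cdot\|_\gamma$ is replaced by $\|\cdot\|_\Gamma$ or $\|\cdot\|_{\mathsf G}$, and when, independently, $\|\cdot\|_\theta$ is replaced by $\|\cdot\|_\Theta$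 or $\|\cdot\|_{\infty,1}$. -/

import Mathlib

open scoped ComplexOrder

namespace Grothendieck

variable {𝕜 : Type*} [RCLike 𝕜] {m n : ℕ}

/-- The value `|∑ᵢⱼ aᵢⱼ ⟨xᵢ, xⱼ⟩|`; over `ℂ` the inner product is conjugate-linear in its first
argument. -/
noncomputable def quadVal {d : ℕ} (A : Matrix (Fin n) (Fin n) 𝕜)
    (x : Fin n → EuclideanSpace 𝕜 (Fin d)) : ℝ :=
  ‖∑ i, ∑ j, A i j * inner 𝕜 (x i) (x j)‖

/-- The value `|∑ᵢⱼ bᵢⱼ ⟨xᵢ, yⱼ⟩|`. -/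
noncomputable def bilinVal {d : ℕ} (B : Matrix (Fin m) (Fin n) 𝕜)
    (x : Fin m → EuclideanSpace 𝕜 (Fin d)) (y : Fin n → EuclideanSpace 𝕜 (Fin d)) : ℝ :=
  ‖∑ i, ∑ j, B i j * inner 𝕜 (x i) (y j)‖

/-- The value `|∑ᵢⱼ aᵢⱼ conj(δᵢ) δⱼ|`. -/
noncomputable def quadScalarVal (A : Matrix (Fin n) (Fin n) 𝕜) (δ : Fin n → 𝕜) : ℝ :=
  ‖∑ i, ∑ j, A i j * (star (δ i) * δ j)‖

/-- The value `|∑ᵢⱼ bᵢⱼ conj(εᵢ) δⱼ|`. -/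
noncomputable def bilinScalarVal (B : Matrix (Fin m) (Fin n) 𝕜)
    (ε : Fin m → 𝕜) (δ : Fin n → 𝕜) : ℝ :=
  ‖∑ i, ∑ j, B i j * (star (ε i) * δ j)‖

/-- The seminorm `‖A‖_γ`: maximum over unit vectors `x₁, …, xₙ ∈ 𝕜ⁿ`. -/
noncomputable def gammaSeminorm (n : ℕ) (A : Matrix (Fin n) (Fin n) 𝕜) : ℝ :=
  sSup {r | ∃ x : Fin n → EuclideanSpace 𝕜 (Fin n), (∀ i, ‖x i‖ = 1) ∧ r = quadVal A x}

/-- The norm `‖A‖_Γ`: maximum over vectors `x₁, …, xₙ` in the unit ball of `𝕜ⁿ`. -/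
noncomputable def capGammaNorm (n : ℕ) (A : Matrix (Fin n) (Fin n) 𝕜) : ℝ :=
  sSup {r | ∃ x : Fin n → EuclideanSpace 𝕜 (Fin n), (∀ i, ‖x i‖ ≤ 1) ∧ r = quadVal A x}

/-- The Grothendieck norm `‖B‖_G` of an `m × n` matrix: maximum over vectors `x₁, …, xₘ`,
`y₁, …, yₙ` in the unit ball of `𝕜^(m+n)`. -/
noncomputable def gNorm (m n : ℕ) (B : Matrix (Fin m) (Fin n) 𝕜) : ℝ :=
  sSup {r | ∃ (x : Fin m → EuclideanSpace 𝕜 (Fin (m + n)))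
    (y : Fin n → EuclideanSpace 𝕜 (Fin (m + n))),
    (∀ i, ‖x i‖ ≤ 1) ∧ (∀ j, ‖y j‖ ≤ 1) ∧ r = bilinVal B x y}

/-- The seminorm `‖A‖_θ`: maximum over scalars of modulus `1`. -/
noncomputable def thetaSeminorm (n : ℕ) (A : Matrix (Fin n) (Fin n) 𝕜) : ℝ :=
  sSup {r | ∃ δ : Fin n → 𝕜, (∀ i, ‖δ i‖ = 1) ∧ r = quadScalarVal A δ}

/-- The norm `‖A‖_Θ`: maximum over scalars of modulus at most `1`. -/
noncomputable def capThetaNorm (n : ℕ) (A : Matrix (Fin n) (Fin n) 𝕜) : ℝ :=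
  sSup {r | ∃ δ : Fin n → 𝕜, (∀ i, ‖δ i‖ ≤ 1) ∧ r = quadScalarVal A δ}

/-- The norm `‖B‖_{∞,1}`: maximum over two families of scalars of modulus at most `1`. -/
noncomputable def inftyOneNorm (m n : ℕ) (B : Matrix (Fin m) (Fin n) 𝕜) : ℝ :=
  sSup {r | ∃ (ε : Fin m → 𝕜) (δ : Fin n → 𝕜),
    (∀ i, ‖ε i‖ ≤ 1) ∧ (∀ j, ‖δ j‖ ≤ 1) ∧ r = bilinScalarVal B ε δ}

/-! All six suprema are attained maxima. -/

theorem isGreatest_sSup_of_isCompact {α : Type*} [TopologicalSpace α] {s : Set α}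
    (hs : IsCompact s) (hne : s.Nonempty) {f : α → ℝ} (hf : Continuous f) {t : Set ℝ}
    (ht : t = f '' s) : IsGreatest t (sSup t) := by
  subst ht
  exact (hs.image hf).isGreatest_sSup (hne.image f)

theorem isCompact_spheres {E : Type*} [SeminormedAddCommGroup E] [ProperSpace E] (n : ℕ) :
    IsCompact {x : Fin n → E | ∀ i, ‖x i‖ = 1} := by
  convert isCompact_univ_pi (fun _ : Fin n => isCompact_sphere (0 : E) 1) using 1
  ext x; simp

theorem isCompact_balls {E : Type*} [SeminormedAddCommGroup E] [ProperSpace E] (n : ℕ) :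
    IsCompact {x : Fin n → E | ∀ i, ‖x i‖ ≤ 1} := by
  convert isCompact_univ_pi (fun _ : Fin n => isCompact_closedBall (0 : E) 1) using 1
  ext x; simp

theorem gammaSeminorm_isGreatest (A : Matrix (Fin n) (Fin n) 𝕜) :
    IsGreatest {r | ∃ x : Fin n → EuclideanSpace 𝕜 (Fin n), (∀ i, ‖x i‖ = 1) ∧ r = quadVal A x}
      (gammaSeminorm n A) := by
  refine isGreatest_sSup_of_isCompact (isCompact_spheres n)
    ⟨fun i => EuclideanSpace.single i 1, fun i => by simp⟩ (f := quadVal A) ?_ ?_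
  · unfold quadVal; fun_prop
  · ext r; simp [eq_comm]

theorem capGammaNorm_isGreatest (A : Matrix (Fin n) (Fin n) 𝕜) :
    IsGreatest {r | ∃ x : Fin n → EuclideanSpace 𝕜 (Fin n), (∀ i, ‖x i‖ ≤ 1) ∧ r = quadVal A x}
      (capGammaNorm n A) := by
  refine isGreatest_sSup_of_isCompact (isCompact_balls n)
    ⟨fun _ => 0, fun i => by simp⟩ (f := quadVal (d := n) A) ?_ ?_
  · unfold quadVal; fun_prop
  · ext r; simp [eq_comm]

theorem gNorm_isGreatest (B : Matrix (Fin m) (Fin n) 𝕜) :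
    IsGreatest {r | ∃ (x : Fin m → EuclideanSpace 𝕜 (Fin (m + n)))
      (y : Fin n → EuclideanSpace 𝕜 (Fin (m + n))),
      (∀ i, ‖x i‖ ≤ 1) ∧ (∀ j, ‖y j‖ ≤ 1) ∧ r = bilinVal B x y} (gNorm m n B) := by
  refine isGreatest_sSup_of_isCompact ((isCompact_balls m).prod (isCompact_balls n))
    ⟨(fun _ => 0, fun _ => 0), by simp⟩ (f := fun p => bilinVal (d := m + n) B p.1 p.2) ?_ ?_
  · unfold bilinVal; fun_prop
  · ext r; simp [eq_comm]

theorem thetaSeminorm_isGreatest (A : Matrix (Fin n) (Fin n) 𝕜) :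
    IsGreatest {r | ∃ δ : Fin n → 𝕜, (∀ i, ‖δ i‖ = 1) ∧ r = quadScalarVal A δ}
      (thetaSeminorm n A) := by
  refine isGreatest_sSup_of_isCompact (isCompact_spheres n)
    ⟨fun _ => 1, fun i => by simp⟩ (f := quadScalarVal A) ?_ ?_
  · unfold quadScalarVal; fun_prop
  · ext r; simp [eq_comm]

theorem capThetaNorm_isGreatest (A : Matrix (Fin n) (Fin n) 𝕜) :
    IsGreatest {r | ∃ δ : Fin n → 𝕜, (∀ i, ‖δ i‖ ≤ 1) ∧ r = quadScalarVal A δ}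
      (capThetaNorm n A) := by
  refine isGreatest_sSup_of_isCompact (isCompact_balls n)
    ⟨fun _ => 0, fun i => by simp⟩ (f := quadScalarVal A) ?_ ?_
  · unfold quadScalarVal; fun_prop
  · ext r; simp [eq_comm]

theorem inftyOneNorm_isGreatest (B : Matrix (Fin m) (Fin n) 𝕜) :
    IsGreatest {r | ∃ (ε : Fin m → 𝕜) (δ : Fin n → 𝕜),
      (∀ i, ‖ε i‖ ≤ 1) ∧ (∀ j, ‖δ j‖ ≤ 1) ∧ r = bilinScalarVal B ε δ} (inftyOneNorm m n B) := by
  refine isGreatest_sSup_of_isCompact ((isCompact_balls m).prod (isCompact_balls n))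
    ⟨(fun _ => 0, fun _ => 0), by simp⟩ (f := fun p => bilinScalarVal B p.1 p.2) ?_ ?_
  · unfold bilinScalarVal; fun_prop
  · ext r; simp [eq_comm]

/-- The three (semi)norms `‖·‖_γ`, `‖·‖_Γ`, `‖·‖_G` on square matrices of all sizes. -/
def vectorNorms (𝕜 : Type*) [RCLike 𝕜] : Set (∀ n : ℕ, Matrix (Fin n) (Fin n) 𝕜 → ℝ) :=
  {gammaSeminorm, capGammaNorm, fun n => gNorm n n}

/-- The three (semi)norms `‖·‖_θ`, `‖·‖_Θ`, `‖·‖_{∞,1}` on square matrices of all sizes. -/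
def scalarNorms (𝕜 : Type*) [RCLike 𝕜] : Set (∀ n : ℕ, Matrix (Fin n) (Fin n) 𝕜 → ℝ) :=
  {thetaSeminorm, capThetaNorm, fun n => inftyOneNorm n n}

/-- The family of cones of positive semidefinite matrices (symmetric over `ℝ`, Hermitian over
`ℂ`). -/
def psdCone (𝕜 : Type*) [RCLike 𝕜] (n : ℕ) : Set (Matrix (Fin n) (Fin n) 𝕜) :=
  {A | A.PosSemidef}

/-- `K` is the conic Grothendieck constant of the family of cones `C`, with respect to the
(semi)norms `N` and `M`: the supremum of `N(A) / M(A)` over all `n` and all `A ∈ Cₙ` for which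
the quotient makes sense. -/
def IsConicConstant (C : ∀ n : ℕ, Set (Matrix (Fin n) (Fin n) 𝕜))
    (N M : ∀ n : ℕ, Matrix (Fin n) (Fin n) 𝕜 → ℝ) (K : ℝ) : Prop :=
  IsLUB {r : ℝ | ∃ (n : ℕ) (A : Matrix (Fin n) (Fin n) 𝕜),
    A ∈ C n ∧ M n A ≠ 0 ∧ r = N n A / M n A} K

end Grothendieck

/-! Both fields are handled at once. Let `z` be a standard Gaussian scalar, `c = 𝔼|z|`
(`gaussianAbs`) and `e = 𝔼|z|²`, the real dimension of `𝕜`. The sharp constant is `e / c²`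
(`psdConstant`), which Gamma values turn into `π/2` and `4/π`.

Upper bound: for unit vectors `xᵢ` and a Gaussian vector `g`, put `uᵢ = ⟨g, xᵢ⟩` and let `sᵢ` be the
phase of `uᵢ`. Then `𝔼[conj(sᵢ) uⱼ] = c⟨xᵢ, xⱼ⟩` and `𝔼[conj(uᵢ) uⱼ] = e⟨xᵢ, xⱼ⟩`. Positivity of `A`
at `s - l u`, averaged with `l = c/e`, gives `(c²/e) ∑ aᵢⱼ⟨xᵢ, xⱼ⟩ ≤ ‖A‖_θ`
(`sesq_sphere_le_thetaSeminorm`). Padding extends this to the ball and Cauchy–Schwarz to the norm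
`G`. Since `γ ≤ Γ ≤ G` and `θ ≤ Θ ≤ (∞,1)`, the pair `(G, θ)` yields every upper bound.

Sharpness: it suffices to treat `γ` against `(∞,1)`. Take Gram matrices of vectors `hᵢ` discretizing
the Gaussian measure on `𝕜ᵈ` (`exists_discretization`). Their `(∞,1)` norm is at most about `c²`,
while a frame inequality bounds `γ` below by `(∑‖hᵢ‖)²/d ≈ (𝔼‖g‖)²/d`, which tends to `e` as `d →
∞`. -/

namespace Grothendieck

/-! ### Moments of the norm of a real Gaussian vector -/

section RealMoments

open MeasureTheory ProbabilityTheory Module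

variable {E : Type*} [NormedAddCommGroup E] [InnerProductSpace ℝ E] [FiniteDimensional ℝ E]
  [MeasurableSpace E] [BorelSpace E]

/-- The standard Gaussian measure has density `(2π)^(-d/2) exp(-‖x‖²/2)`. -/
theorem stdGaussian_eq_withDensity :
    stdGaussian E = volume.withDensity (fun x : E => ENNReal.ofReal
      ((2 * Real.pi) ^ (-(finrank ℝ E : ℝ) / 2) * Real.exp (-(1 / 2) * ‖x‖ ^ 2))) := by
  have hpi : (0 : ℝ) < 2 * Real.pi := by positivity
  have hint : Integrable (fun x : E => (2 * Real.pi) ^ (-(finrank ℝ E : ℝ) / 2) *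
      Real.exp (-(1 / 2) * ‖x‖ ^ 2)) := by
    refine Integrable.const_mul ?_ _
    have h := (GaussianFourier.integrable_cexp_neg_mul_sq_norm_add (V := E)
      (b := ((1 / 2 : ℝ) : ℂ)) (by norm_num) 0 0).norm
    refine h.congr (ae_of_all _ fun x => ?_)
    simp only [Complex.norm_exp]
    congr 1
    simp [← Complex.ofReal_pow]
  have : IsFiniteMeasure (volume.withDensity (fun x : E => ENNReal.ofReal
      ((2 * Real.pi) ^ (-(finrank ℝ E : ℝ) / 2) * Real.exp (-(1 / 2) * ‖x‖ ^ 2)))) :=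
    isFiniteMeasure_withDensity_ofReal hint.2
  -- The two characteristic functions agree by the Fourier transform of `exp(-b‖x‖²)` at `b = 1/2`.
  refine Measure.ext_of_charFun ?_
  ext t
  rw [charFun_stdGaussian, charFun_apply, integral_withDensity_eq_integral_toReal_smul
    (by fun_prop) (ae_of_all _ fun x => ENNReal.ofReal_lt_top)]
  have h := GaussianFourier.integral_cexp_neg_mul_sq_norm_add (V := E)
    (b := ((1 / 2 : ℝ) : ℂ)) (by norm_num) Complex.I t
  have h2 : ∀ x : E, (ENNReal.ofReal ((2 * Real.pi) ^ (-(finrank ℝ E : ℝ) / 2) *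
      Real.exp (-(1 / 2) * ‖x‖ ^ 2))).toReal • Complex.exp (inner ℝ x t * Complex.I)
      = (((2 * Real.pi) ^ (-(finrank ℝ E : ℝ) / 2) : ℝ) : ℂ) *
        Complex.exp (-((1 / 2 : ℝ) : ℂ) * ‖x‖ ^ 2 + Complex.I * inner ℝ t x) := by
    intro x
    rw [ENNReal.toReal_ofReal (by positivity), Complex.real_smul, Complex.exp_add,
      real_inner_comm x t]
    push_cast
    ring_nf
  simp_rw [h2]
  rw [integral_const_mul, h]
  have h3 : (Real.pi / ((1 / 2 : ℝ) : ℂ)) ^ ((finrank ℝ E : ℂ) / 2) =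
      (((2 * Real.pi) ^ ((finrank ℝ E : ℝ) / 2) : ℝ) : ℂ) := by
    rw [Complex.ofReal_cpow hpi.le]
    push_cast
    congr 1
    ring
  rw [h3, ← mul_assoc, ← Complex.ofReal_mul, ← Real.rpow_add hpi]
  rw [neg_div (2 : ℝ) (finrank ℝ E : ℝ), neg_add_cancel, Real.rpow_zero, neg_div]
  simp only [Complex.ofReal_one, one_mul, Complex.I_sq]
  congr 1
  push_cast
  ring

/-- Polar coordinates reduce each moment to a Gamma integral over the radius. -/
theorem integral_norm_pow_stdGaussian [Nontrivial E] (k : ℕ) :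
    ∫ x, ‖x‖ ^ k ∂stdGaussian E =
      2 ^ ((k : ℝ) / 2) * Real.Gamma (((finrank ℝ E : ℝ) + k) / 2) /
        Real.Gamma ((finrank ℝ E : ℝ) / 2) := by
  have hD : 0 < finrank ℝ E := finrank_pos
  set D := finrank ℝ E with hDdef
  have hD' : (0 : ℝ) < D := by exact_mod_cast hD
  set C : ℝ := (2 * Real.pi) ^ (-(D : ℝ) / 2) with hC
  set V : ℝ := D • (volume : Measure E).real (Metric.ball 0 1) with hV
  have key : ∀ m : ℕ, ∫ x, ‖x‖ ^ m ∂stdGaussian E =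
      C * V * ((1 / 2 : ℝ) ^ (-((D : ℝ) + m) / 2) * (1 / 2) * Real.Gamma (((D : ℝ) + m) / 2)) := by
    intro m
    rw [stdGaussian_eq_withDensity, integral_withDensity_eq_integral_toReal_smul
      (by fun_prop) (ae_of_all _ fun x => ENNReal.ofReal_lt_top)]
    have h1 : ∀ x : E, (ENNReal.ofReal (C * Real.exp (-(1 / 2) * ‖x‖ ^ 2))).toReal • ‖x‖ ^ m =
        C * (fun r : ℝ => r ^ m * Real.exp (-(1 / 2) * r ^ 2)) ‖x‖ := by
      intro x
      rw [ENNReal.toReal_ofReal (by positivity), smul_eq_mul]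
      ring
    simp_rw [← hDdef, ← hC, h1]
    rw [integral_const_mul, integral_fun_norm_addHaar volume
      (fun r : ℝ => r ^ m * Real.exp (-(1 / 2) * r ^ 2))]
    have h2 : ∫ y in Set.Ioi (0 : ℝ), y ^ (finrank ℝ E - 1) • (y ^ m * Real.exp (-(1 / 2) * y ^ 2))
        = (1 / 2 : ℝ) ^ (-((D : ℝ) + m) / 2) * (1 / 2) * Real.Gamma (((D : ℝ) + m) / 2) := by
      have h3 := _root_.integral_rpow_mul_exp_neg_mul_rpow (p := 2) (q := (D : ℝ) + m - 1)
        (b := 1 / 2) (by norm_num) (by have : (0 : ℝ) ≤ m := m.cast_nonneg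
                                       linarith) (by norm_num)
      rw [sub_add_cancel] at h3
      rw [← h3]
      refine setIntegral_congr_fun measurableSet_Ioi fun y hy => ?_
      have hy : 0 < y := hy
      simp only [smul_eq_mul]
      rw [← mul_assoc, ← pow_add, ← Real.rpow_natCast y (finrank ℝ E - 1 + m)]
      congr 2
      · rw [← hDdef]; push_cast [Nat.cast_sub (show 1 ≤ D from hD)]; ring
      · norm_num
    rw [h2, ← hDdef, hV]
    simp only [smul_eq_mul, nsmul_eq_mul]
    ring
  -- The zeroth moment is the total mass 1, which fixes `C * V`; the volume of the unit ball is
  -- never computed.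
  have h0 := key 0
  simp only [pow_zero, integral_const, probReal_univ, smul_eq_mul, mul_one, Nat.cast_zero,
    add_zero] at h0
  have hG : 0 < Real.Gamma ((D : ℝ) / 2) := Real.Gamma_pos_of_pos (by positivity)
  rw [key k, eq_div_iff hG.ne']
  have h4 : (1 / 2 : ℝ) ^ (-((D : ℝ) + k) / 2) =
      (1 / 2 : ℝ) ^ (-(D : ℝ) / 2) * 2 ^ ((k : ℝ) / 2) := by
    rw [show -((D : ℝ) + k) / 2 = -(D : ℝ) / 2 + -((k : ℝ) / 2) by ring,
      Real.rpow_add (by norm_num), Real.rpow_neg (by norm_num) ((k : ℝ) / 2), one_div,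
      Real.inv_rpow (by norm_num) ((k : ℝ) / 2), inv_inv]
  rw [h4]
  linear_combination (-(2 ^ ((k : ℝ) / 2) * Real.Gamma (((D : ℝ) + k) / 2))) * h0

theorem integral_norm_sq_stdGaussian [Nontrivial E] :
    ∫ x, ‖x‖ ^ 2 ∂stdGaussian E = finrank ℝ E := by
  have hD : (0 : ℝ) < finrank ℝ E := by exact_mod_cast finrank_pos
  rw [integral_norm_pow_stdGaussian, div_eq_iff (Real.Gamma_pos_of_pos (by positivity)).ne',
    show ((finrank ℝ E : ℝ) + (2 : ℕ)) / 2 = (finrank ℝ E : ℝ) / 2 + 1 by push_cast; ring,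
    Real.Gamma_add_one (by positivity)]
  norm_num
  ring

theorem integral_norm_pow_four_stdGaussian [Nontrivial E] :
    ∫ x, ‖x‖ ^ 4 ∂stdGaussian E = finrank ℝ E * (finrank ℝ E + 2) := by
  have hD : (0 : ℝ) < finrank ℝ E := by exact_mod_cast finrank_pos
  rw [integral_norm_pow_stdGaussian, div_eq_iff (Real.Gamma_pos_of_pos (by positivity)).ne',
    show ((finrank ℝ E : ℝ) + (4 : ℕ)) / 2 = (finrank ℝ E : ℝ) / 2 + 1 + 1 by push_cast; ring,
    Real.Gamma_add_one (by positivity), Real.Gamma_add_one (by positivity),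
    show (((4 : ℕ) : ℝ) / 2) = (2 : ℕ) by norm_num, Real.rpow_natCast]
  ring

theorem integrable_norm_pow_stdGaussian (k : ℕ) :
    Integrable (fun x : E => ‖x‖ ^ k) (stdGaussian E) := by
  exact (IsGaussian.memLp_id (stdGaussian E) k (by simp)).integrable_norm_pow'

/-- The second and fourth moments suffice to show that the mean norm is asymptotically at least
`√D`, so no asymptotics of Gamma quotients are needed. -/
theorem sqrt_mul_le_integral_norm_stdGaussian [Nontrivial E] :
    √(finrank ℝ E) * (1 - 1 / (finrank ℝ E : ℝ)) ≤ ∫ x, ‖x‖ ∂stdGaussian E := by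
  have hD : (0 : ℝ) < finrank ℝ E := by exact_mod_cast finrank_pos
  set D : ℝ := (finrank ℝ E : ℝ) with hDdef
  have hs : √D ^ 2 = D := Real.sq_sqrt hD.le
  have hs0 : 0 < √D := Real.sqrt_pos.2 hD
  -- With `r = ‖x‖/√D` this is `3r² - r⁴ ≤ 2r`, that is `r(r - 1)²(r + 2) ≥ 0`, with equality at the
  -- typical radius `r = 1`.
  have hpt : ∀ x : E, √D * (3 / (2 * D) * ‖x‖ ^ 2 - 1 / (2 * D ^ 2) * ‖x‖ ^ 4) ≤ ‖x‖ := by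
    intro x
    obtain ⟨r, hr⟩ : ∃ r, r = ‖x‖ / √D := ⟨_, rfl⟩
    have hr0 : 0 ≤ r := hr ▸ by positivity
    have hx : ‖x‖ = √D * r := by rw [hr]; field_simp
    have h4 : √D ^ 4 = D ^ 2 := by rw [show √D ^ 4 = (√D ^ 2) ^ 2 by ring, hs]
    rw [hx, mul_pow, mul_pow, hs, h4]
    refine mul_le_mul_of_nonneg_left ?_ hs0.le
    have : 3 / (2 * D) * (D * r ^ 2) - 1 / (2 * D ^ 2) * (D ^ 2 * r ^ 4) =
        (3 * r ^ 2 - r ^ 4) / 2 := by field_simp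
    rw [this]
    nlinarith [mul_nonneg hr0 (mul_nonneg (sq_nonneg (r - 1)) (by linarith : 0 ≤ r + 2))]
  have h2 := (integrable_norm_pow_stdGaussian (E := E) 2).const_mul (3 / (2 * D))
  have h4 := (integrable_norm_pow_stdGaussian (E := E) 4).const_mul (1 / (2 * D ^ 2))
  have h1 : Integrable (fun x : E => ‖x‖) (stdGaussian E) := by
    simpa using integrable_norm_pow_stdGaussian (E := E) 1
  refine le_trans (le_of_eq ?_) (integral_mono ((h2.sub h4).const_mul √D) h1 hpt)
  rw [integral_const_mul, integral_sub' h2 h4, integral_const_mul, integral_const_mul,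
    integral_norm_sq_stdGaussian, integral_norm_pow_four_stdGaussian, ← hDdef]
  field_simp
  ring

end RealMoments

/-! ### Gaussian measures over `𝕜` and their symmetries -/

section GaussianMeasure

open MeasureTheory ProbabilityTheory Module

variable (𝕜 : Type*) [RCLike 𝕜] {E F : Type*} [NormedAddCommGroup E] [InnerProductSpace 𝕜 E]
  [FiniteDimensional 𝕜 E] [MeasurableSpace E] [BorelSpace E]
  [NormedAddCommGroup F] [InnerProductSpace 𝕜 F]
  [FiniteDimensional 𝕜 F] [MeasurableSpace F] [BorelSpace F]

theorem finiteDimensional_rclikeToReal (E : Type*) [NormedAddCommGroup E] [InnerProductSpace 𝕜 E]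
    [FiniteDimensional 𝕜 E] :
    let := InnerProductSpace.rclikeToReal 𝕜 E
    FiniteDimensional ℝ E := by
  let := InnerProductSpace.rclikeToReal 𝕜 E
  have : IsScalarTower ℝ 𝕜 E := IsScalarTower.of_algebraMap_smul fun _ _ => rfl
  exact FiniteDimensional.trans ℝ 𝕜 E

theorem finrank_rclikeToReal (E : Type*) [NormedAddCommGroup E] [InnerProductSpace 𝕜 E]
    [FiniteDimensional 𝕜 E] :
    let := InnerProductSpace.rclikeToReal 𝕜 E
    finrank ℝ E = finrank ℝ 𝕜 * finrank 𝕜 E := by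
  let := InnerProductSpace.rclikeToReal 𝕜 E
  have : IsScalarTower ℝ 𝕜 E := IsScalarTower.of_algebraMap_smul fun _ _ => rfl
  exact (finrank_mul_finrank ℝ 𝕜 E).symm

variable (E) in
/-- The standard Gaussian measure on `E` seen as a real inner product space. -/
noncomputable def gaussian : Measure E :=
  letI := InnerProductSpace.rclikeToReal 𝕜 E
  haveI := finiteDimensional_rclikeToReal 𝕜 E
  stdGaussian E

instance : IsProbabilityMeasure (gaussian 𝕜 E) := by
  let := InnerProductSpace.rclikeToReal 𝕜 E
  have := finiteDimensional_rclikeToReal 𝕜 E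
  exact isProbabilityMeasure_stdGaussian

theorem integrable_norm_pow_gaussian (k : ℕ) :
    Integrable (fun x : E => ‖x‖ ^ k) (gaussian 𝕜 E) := by
  let := InnerProductSpace.rclikeToReal 𝕜 E
  have := finiteDimensional_rclikeToReal 𝕜 E
  exact integrable_norm_pow_stdGaussian k

/-- The standard Gaussian measure is mapped to the standard Gaussian measure by any linear map
with an isometric adjoint. -/
theorem gaussian_map (L : E →L[𝕜] F) (L' : F → E) (hL' : ∀ t, ‖L' t‖ = ‖t‖)
    (hL : ∀ x t, inner 𝕜 (L x) t = inner 𝕜 x (L' t)) :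
    (gaussian 𝕜 E).map L = gaussian 𝕜 F := by
  let := InnerProductSpace.rclikeToReal 𝕜 E
  have := finiteDimensional_rclikeToReal 𝕜 E
  let := InnerProductSpace.rclikeToReal 𝕜 F
  have := finiteDimensional_rclikeToReal 𝕜 F
  have hLm : Measurable L := L.continuous.measurable
  have : IsProbabilityMeasure ((gaussian 𝕜 E).map L) :=
    Measure.isProbabilityMeasure_map hLm.aemeasurable
  refine Measure.ext_of_charFun ?_
  ext t
  have h1 : charFun (gaussian 𝕜 F) t = Complex.exp (-‖t‖ ^ 2 / 2) := charFun_stdGaussian t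
  have h2 : charFun (gaussian 𝕜 E) (L' t) = Complex.exp (-‖L' t‖ ^ 2 / 2) :=
    charFun_stdGaussian (L' t)
  rw [h1, ← hL' t, ← h2, charFun_apply, charFun_apply, integral_map hLm.aemeasurable
    (by fun_prop)]
  refine integral_congr_ae (ae_of_all _ fun x => ?_)
  -- The underlying real inner product is the real part of the one over `𝕜`.
  have : (inner ℝ (L x) t : ℝ) = inner ℝ x (L' t) := congrArg RCLike.re (hL x t)
  simp only [this]

/-- The left side uses the real structure inherited from the inner product over `𝕜`, the right side
the native one. -/
theorem finrank_rclikeToReal_self :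
    (letI := InnerProductSpace.rclikeToReal 𝕜 𝕜; finrank ℝ 𝕜) = finrank ℝ 𝕜 := by
  rw [finrank_rclikeToReal 𝕜 𝕜, finrank_self, mul_one]

/-- The mean absolute value of a standard Gaussian scalar. -/
noncomputable def gaussianAbs : ℝ := ∫ z, ‖z‖ ∂gaussian 𝕜 𝕜

theorem gaussianAbs_eq : gaussianAbs 𝕜 =
    2 ^ ((1 : ℝ) / 2) * Real.Gamma (((finrank ℝ 𝕜 : ℝ) + 1) / 2) /
        Real.Gamma ((finrank ℝ 𝕜 : ℝ) / 2) := by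
  have h := finrank_rclikeToReal_self 𝕜
  let := InnerProductSpace.rclikeToReal 𝕜 𝕜
  have := finiteDimensional_rclikeToReal 𝕜 𝕜
  have := integral_norm_pow_stdGaussian (E := 𝕜) 1
  simp only [pow_one, h] at this
  simpa [gaussianAbs, gaussian] using this

theorem finrank_real_pos : 0 < finrank ℝ 𝕜 := finrank_pos

theorem gaussianAbs_pos : 0 < gaussianAbs 𝕜 := by
  have h : (0 : ℝ) < finrank ℝ 𝕜 := by exact_mod_cast finrank_real_pos 𝕜
  rw [gaussianAbs_eq]
  have h1 := Real.Gamma_pos_of_pos (show (0 : ℝ) < ((finrank ℝ 𝕜 : ℝ) + 1) / 2 by positivity)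
  have h2 := Real.Gamma_pos_of_pos (show (0 : ℝ) < (finrank ℝ 𝕜 : ℝ) / 2 by positivity)
  positivity

theorem integral_norm_sq_gaussian_self : ∫ z, ‖z‖ ^ 2 ∂gaussian 𝕜 𝕜 = finrank ℝ 𝕜 := by
  have h := finrank_rclikeToReal_self 𝕜
  let := InnerProductSpace.rclikeToReal 𝕜 𝕜
  have := finiteDimensional_rclikeToReal 𝕜 𝕜
  have := integral_norm_sq_stdGaussian (E := 𝕜)
  rw [h] at this
  exact this

theorem sqrt_mul_le_integral_norm_gaussian [Nontrivial E] :
    √(finrank ℝ 𝕜 * finrank 𝕜 E) * (1 - 1 / (finrank ℝ 𝕜 * finrank 𝕜 E : ℝ)) ≤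
      ∫ x, ‖x‖ ∂gaussian 𝕜 E := by
  have h := finrank_rclikeToReal 𝕜 E
  let := InnerProductSpace.rclikeToReal 𝕜 E
  have := finiteDimensional_rclikeToReal 𝕜 E
  have := sqrt_mul_le_integral_norm_stdGaussian (E := E)
  rw [h] at this
  push_cast at this
  exact this

variable {𝕜}

theorem gaussian_map_inner {x : E} (hx : ‖x‖ = 1) :
    (gaussian 𝕜 E).map (fun g => inner 𝕜 x g) = gaussian 𝕜 𝕜 :=
  gaussian_map 𝕜 (innerSL 𝕜 x) (fun t => t • x) (by simp [norm_smul, hx]) fun g t => by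
    simp [inner_smul_right]

theorem integral_norm_inner_gaussian {x : E} (hx : ‖x‖ = 1) :
    ∫ g, ‖inner 𝕜 x g‖ ∂gaussian 𝕜 E = gaussianAbs 𝕜 := by
  rw [gaussianAbs, ← gaussian_map_inner hx, integral_map (by fun_prop) (by fun_prop)]

theorem integral_norm_inner_sq_gaussian {x : E} (hx : ‖x‖ = 1) :
    ∫ g, ‖inner 𝕜 x g‖ ^ 2 ∂gaussian 𝕜 E = finrank ℝ 𝕜 := by
  rw [← integral_norm_sq_gaussian_self, ← gaussian_map_inner hx,
    integral_map (by fun_prop) (by fun_prop)]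

/-- Invariance of the Gaussian measure under the reflection that fixes the line of `x`. -/
theorem gaussian_map_reflection {x : E} (hx : ‖x‖ = 1) :
    (gaussian 𝕜 E).map (fun g => (2 : 𝕜) • (inner 𝕜 x g • x) - g) = gaussian 𝕜 E := by
  have hc : (starRingEnd 𝕜) 2 = 2 := map_ofNat _ 2
  refine gaussian_map 𝕜 ((2 : 𝕜) • (innerSL 𝕜 x).smulRight x - ContinuousLinearMap.id 𝕜 E)
    (fun g => (2 : 𝕜) • (inner 𝕜 x g • x) - g) (fun t => ?_) fun g t => ?_
  · have h2 : inner 𝕜 x x = 1 := by rw [inner_self_eq_norm_sq_to_K, hx]; simp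
    rw [← sq_eq_sq₀ (norm_nonneg _) (norm_nonneg _), ← RCLike.ofReal_inj (K := 𝕜)]
    push_cast
    rw [← inner_self_eq_norm_sq_to_K, ← inner_self_eq_norm_sq_to_K]
    simp only [inner_sub_left, inner_sub_right, inner_smul_left, inner_smul_right, h2,
      inner_conj_symm]
    simp [hc]
    ring
  · simp only [sub_apply, smul_apply,
      ContinuousLinearMap.smulRight_apply, innerSL_apply_apply, ContinuousLinearMap.id_apply,
      inner_sub_left, inner_sub_right, inner_smul_left, inner_smul_right, inner_conj_symm]
    simp [hc]
    ring

/-- A Gaussian vector `g` tested against any function of `⟨x, g⟩` only sees the component of `g`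
along `x`. -/
theorem integral_mul_inner_gaussian {x y : E} (hx : ‖x‖ = 1) {f : 𝕜 → 𝕜} (hf : Measurable f)
    (hi : ∀ z : E, Integrable (fun g => f (inner 𝕜 g x) * inner 𝕜 g z) (gaussian 𝕜 E)) :
    ∫ g, f (inner 𝕜 g x) * inner 𝕜 g y ∂gaussian 𝕜 E =
      (∫ g, f (inner 𝕜 g x) * inner 𝕜 g x ∂gaussian 𝕜 E) * inner 𝕜 x y := by
  have h2 : inner 𝕜 x x = 1 := by rw [inner_self_eq_norm_sq_to_K, hx]; simp
  have hc : (starRingEnd 𝕜) 2 = 2 := map_ofNat _ 2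
  have hm : Measurable (fun g : E => f (inner 𝕜 g x) * inner 𝕜 g y) := by fun_prop
  have h : ∫ g, f (inner 𝕜 g x) * inner 𝕜 g y ∂gaussian 𝕜 E =
      ∫ g, (2 * inner 𝕜 x y) * (f (inner 𝕜 g x) * inner 𝕜 g x) - f (inner 𝕜 g x) * inner 𝕜 g y
        ∂gaussian 𝕜 E := by
    -- The reflection keeps `⟨g, x⟩` and sends `⟨g, y⟩` to `2⟨g, x⟩⟨x, y⟩ - ⟨g, y⟩`; solving the
    -- resulting equation for the integral gives the claim.
    conv_lhs => rw [← gaussian_map_reflection (𝕜 := 𝕜) hx]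
    rw [integral_map (Continuous.measurable (by fun_prop)).aemeasurable hm.aestronglyMeasurable]
    refine integral_congr_ae (ae_of_all _ fun g => ?_)
    have h3 : inner 𝕜 ((2 : 𝕜) • (inner 𝕜 x g • x) - g) x = inner 𝕜 g x := by
      simp only [inner_sub_left, inner_smul_left, h2, inner_conj_symm]
      simp [hc]
      ring
    simp only [h3]
    simp only [inner_sub_left, inner_smul_left, inner_conj_symm, hc]
    ring
  rw [integral_sub ((hi x).const_mul _) (hi y), integral_const_mul] at h
  have h5 : (2 : 𝕜) ≠ 0 := two_ne_zero
  refine mul_left_cancel₀ h5 ?_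
  linear_combination h

end GaussianMeasure

/-! ### Positive semidefinite forms evaluated on vectors -/

section QuadraticForm

variable {𝕜 E F : Type*} [RCLike 𝕜] {n : ℕ} [NormedAddCommGroup E] [InnerProductSpace 𝕜 E]
  [NormedAddCommGroup F] [InnerProductSpace 𝕜 F]

/-- The sesquilinear value `∑ᵢⱼ aᵢⱼ ⟨xᵢ, yⱼ⟩`. -/
noncomputable def sesq (A : Matrix (Fin n) (Fin n) 𝕜) (x y : Fin n → E) : 𝕜 :=
  ∑ i, ∑ j, A i j * inner 𝕜 (x i) (y j)

theorem sesq_congr {A : Matrix (Fin n) (Fin n) 𝕜} {x y : Fin n → E} {x' y' : Fin n → F}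
    (h : ∀ i j, inner 𝕜 (x' i) (y' j) = inner 𝕜 (x i) (y j)) : sesq A x' y' = sesq A x y := by
  simp [sesq, h]

/-- Isometric embeddings between finite-dimensional inner product spaces exist when the dimensions
allow it. -/
theorem exists_linearIsometry_of_finrank_le [FiniteDimensional 𝕜 E] {m : ℕ}
    (h : Module.finrank 𝕜 E ≤ m) : Nonempty (E →ₗᵢ[𝕜] EuclideanSpace 𝕜 (Fin m)) := by
  let b := stdOrthonormalBasis 𝕜 E
  let w : Fin (Module.finrank 𝕜 E) → EuclideanSpace 𝕜 (Fin m) :=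
    fun i => EuclideanSpace.basisFun (Fin m) 𝕜 (Fin.castLE h i)
  have hw : Orthonormal 𝕜 w :=
    (EuclideanSpace.basisFun (Fin m) 𝕜).orthonormal.comp _ (Fin.castLE_injective h)
  refine ⟨LinearMap.isometryOfOrthonormal (b.toBasis.constr 𝕜 w) (v := b.toBasis) ?_ ?_⟩
  · simp
  · convert hw
    ext1 i
    simp [Function.comp]

/-- Any `n` vectors have the same Gram matrix as `n` vectors of `𝕜ⁿ`. -/
theorem exists_euclidean_inner_eq (x : Fin n → E) {m : ℕ} (hnm : n ≤ m) :
    ∃ y : Fin n → EuclideanSpace 𝕜 (Fin m), ∀ i j, inner 𝕜 (y i) (y j) = inner 𝕜 (x i) (x j) := by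
  have hfin : FiniteDimensional 𝕜 (Submodule.span 𝕜 (Set.range x)) :=
    FiniteDimensional.span_of_finite 𝕜 (Set.finite_range x)
  have hrank : Module.finrank 𝕜 (Submodule.span 𝕜 (Set.range x)) ≤ m := by
    have h : Module.finrank 𝕜 (Submodule.span 𝕜 (Set.range x)) ≤ n := by
      simpa [Set.finrank] using finrank_range_le_card (R := 𝕜) x
    exact h.trans hnm
  obtain ⟨f⟩ := exists_linearIsometry_of_finrank_le hrank
  exact ⟨fun i => f ⟨x i, Submodule.subset_span ⟨i, rfl⟩⟩, fun i j => by
    rw [f.inner_map_map]; rfl⟩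

/-- Only the Gram matrix matters, so the vectors may lie in `𝕜ⁿ`, where the value splits into one
scalar quadratic form per coordinate. -/
theorem sesq_self_nonneg {A : Matrix (Fin n) (Fin n) 𝕜} (hA : A.PosSemidef) (x : Fin n → E) :
    0 ≤ sesq A x x := by
  obtain ⟨y, hy⟩ := exists_euclidean_inner_eq (𝕜 := 𝕜) x le_rfl
  rw [← sesq_congr hy]
  have h : sesq A y y = ∑ k, dotProduct (star fun i => y i k) (A.mulVec fun i => y i k) := by
    simp only [sesq, PiLp.inner_apply, RCLike.inner_apply, dotProduct, Matrix.mulVec,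
      Finset.mul_sum, Pi.star_apply]
    rw [Finset.sum_congr rfl fun i _ => Finset.sum_comm, Finset.sum_comm]
    refine Finset.sum_congr rfl fun k _ => Finset.sum_congr rfl fun i _ =>
      Finset.sum_congr rfl fun j _ => ?_
    rw [starRingEnd_apply]
    ring
  rw [h]
  exact Finset.sum_nonneg fun k _ => hA.dotProduct_mulVec_nonneg _

theorem sesq_sub_sub (A : Matrix (Fin n) (Fin n) 𝕜) (x y : Fin n → E) :
    sesq A (x - y) (x - y) = sesq A x x - (sesq A x y + sesq A y x) + sesq A y y := by
  simp only [sesq, ← Finset.sum_add_distrib, ← Finset.sum_sub_distrib, Pi.sub_apply]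
  refine Finset.sum_congr rfl fun i _ => Finset.sum_congr rfl fun j _ => ?_
  simp only [inner_sub_left, inner_sub_right]
  ring

theorem star_sesq {A : Matrix (Fin n) (Fin n) 𝕜} (hA : A.IsHermitian) (x y : Fin n → E) :
    (starRingEnd 𝕜) (sesq A x y) = sesq A y x := by
  simp only [sesq, map_sum, map_mul, inner_conj_symm]
  rw [Finset.sum_comm]
  refine Finset.sum_congr rfl fun i _ => Finset.sum_congr rfl fun j _ => ?_
  rw [← hA.apply i j, starRingEnd_apply]

theorem sesq_smul_right (A : Matrix (Fin n) (Fin n) 𝕜) (c : 𝕜) (x y : Fin n → E) :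
    sesq A x (c • y) = c * sesq A x y := by
  simp only [sesq, Finset.mul_sum, Pi.smul_apply, inner_smul_right]
  exact Finset.sum_congr rfl fun i _ => Finset.sum_congr rfl fun j _ => by ring

theorem sesq_smul_left (A : Matrix (Fin n) (Fin n) 𝕜) (c : 𝕜) (x y : Fin n → E) :
    sesq A (c • x) y = (starRingEnd 𝕜) c * sesq A x y := by
  simp only [sesq, Finset.mul_sum, Pi.smul_apply, inner_smul_left]
  exact Finset.sum_congr rfl fun i _ => Finset.sum_congr rfl fun j _ => by ring

theorem two_mul_norm_sesq_le {A : Matrix (Fin n) (Fin n) 𝕜} (hA : A.PosSemidef)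
    (x y : Fin n → E) :
    2 * ‖sesq A x y‖ ≤ RCLike.re (sesq A x x) + RCLike.re (sesq A y y) := by
  -- A unimodular factor makes the cross term real and nonnegative; positivity at `x - c • y` then
  -- gives the bound.
  obtain ⟨c, hc, hc'⟩ : ∃ c : 𝕜, ‖c‖ = 1 ∧ c * sesq A x y = ‖sesq A x y‖ := by
    by_cases h : sesq A x y = 0
    · exact ⟨1, by simp [h]⟩
    · have h' : (‖sesq A x y‖ : 𝕜) ≠ 0 := by simpa using h
      refine ⟨(starRingEnd 𝕜) (sesq A x y) / ‖sesq A x y‖, ?_, ?_⟩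
      · rw [norm_div, RCLike.norm_conj, RCLike.norm_ofReal, abs_norm, div_self (by simpa using h)]
      · rw [div_mul_eq_mul_div, RCLike.conj_mul, sq, mul_div_assoc, div_self h', mul_one]
  have h := (RCLike.nonneg_iff.1 (sesq_self_nonneg hA (x - c • y))).1
  rw [sesq_sub_sub, ← star_sesq hA.1 x (c • y), sesq_smul_right A c x y, hc', sesq_smul_right,
    sesq_smul_left, ← mul_assoc, RCLike.mul_conj, hc] at h
  simp at h
  linarith

end QuadraticForm

/-! ### Rounding vectors to unimodular scalars -/

section Rounding

open MeasureTheory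

variable {𝕜 : Type*} [RCLike 𝕜] {n : ℕ}

/-- The direction of a scalar, with the convention that `0` has direction `1`. -/
noncomputable def phase (z : 𝕜) : 𝕜 := if z = 0 then 1 else z / (‖z‖ : 𝕜)

/-- Thanks to the value at `0` there is no exceptional set: phases are always admissible for
`‖·‖_θ`. -/
theorem norm_phase (z : 𝕜) : ‖phase z‖ = 1 := by
  unfold phase
  split_ifs with h
  · simp
  · rw [norm_div, RCLike.norm_ofReal, abs_norm, div_self (by simpa using h)]

theorem conj_phase_mul_self (z : 𝕜) : (starRingEnd 𝕜) (phase z) * z = ‖z‖ := by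
  unfold phase
  split_ifs with h
  · simp [h]
  · have h' : (‖z‖ : 𝕜) ≠ 0 := by simpa using h
    rw [map_div₀, RCLike.conj_ofReal, div_mul_eq_mul_div, RCLike.conj_mul, sq, mul_div_assoc,
      div_self h', mul_one]

theorem measurable_phase : Measurable (phase : 𝕜 → 𝕜) :=
  Measurable.ite (measurableSet_singleton 0) measurable_const (by fun_prop)

variable {E : Type*} [NormedAddCommGroup E] [InnerProductSpace 𝕜 E]
  [FiniteDimensional 𝕜 E] [MeasurableSpace E] [BorelSpace E]

theorem integrable_inner_gaussian (z : E) :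
    Integrable (fun g => inner 𝕜 g z) (gaussian 𝕜 E) := by
  have h : Integrable (fun g : E => ‖g‖) (gaussian 𝕜 E) := by
    simpa using integrable_norm_pow_gaussian 𝕜 (E := E) 1
  refine (h.mul_const ‖z‖).mono' (by fun_prop) (ae_of_all _ fun g => norm_inner_le_norm g z)

theorem integrable_conj_phase_mul_inner (x z : E) :
    Integrable (fun g => (starRingEnd 𝕜) (phase (inner 𝕜 g x)) * inner 𝕜 g z)
      (gaussian 𝕜 E) := by
  have hm : Measurable fun g : E => (starRingEnd 𝕜) (phase (inner 𝕜 g x)) :=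
    RCLike.continuous_conj.measurable.comp (measurable_phase.comp (by fun_prop))
  refine (integrable_inner_gaussian z).norm.mono'
    (hm.mul (by fun_prop)).aestronglyMeasurable (ae_of_all _ fun g => ?_)
  rw [norm_mul, RCLike.norm_conj, norm_phase, one_mul]

theorem integrable_conj_inner_mul_inner (x z : E) :
    Integrable (fun g => (starRingEnd 𝕜) (inner 𝕜 g x) * inner 𝕜 g z) (gaussian 𝕜 E) := by
  refine ((integrable_norm_pow_gaussian 𝕜 (E := E) 2).mul_const (‖x‖ * ‖z‖)).mono'
    ((RCLike.continuous_conj.comp (by fun_prop)).mul (by fun_prop)).aestronglyMeasurable (ae_of_all _ fun g => ?_)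
  rw [norm_mul, RCLike.norm_conj]
  calc ‖inner 𝕜 g x‖ * ‖inner 𝕜 g z‖ ≤ (‖g‖ * ‖x‖) * (‖g‖ * ‖z‖) := by
        gcongr <;> exact norm_inner_le_norm _ _
    _ = _ := by ring

/-- By reflection symmetry only the component of `y` along `x` survives, and `conj(phase z) * z =
|z|` leaves the first absolute moment. -/
theorem integral_conj_phase_mul_inner {x : E} (hx : ‖x‖ = 1) (y : E) :
    ∫ g, (starRingEnd 𝕜) (phase (inner 𝕜 g x)) * inner 𝕜 g y ∂gaussian 𝕜 E =
      gaussianAbs 𝕜 * inner 𝕜 x y := by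
  rw [integral_mul_inner_gaussian (f := fun z => (starRingEnd 𝕜) (phase z)) hx
    (RCLike.continuous_conj.measurable.comp measurable_phase)
    (integrable_conj_phase_mul_inner x)]
  simp_rw [conj_phase_mul_self]
  rw [integral_ofReal, ← integral_norm_inner_gaussian hx]
  simp_rw [norm_inner_symm]

theorem integral_conj_inner_mul_inner {x : E} (hx : ‖x‖ = 1) (y : E) :
    ∫ g, (starRingEnd 𝕜) (inner 𝕜 g x) * inner 𝕜 g y ∂gaussian 𝕜 E =
      Module.finrank ℝ 𝕜 * inner 𝕜 x y := by
  rw [integral_mul_inner_gaussian (f := fun z => (starRingEnd 𝕜) z) hx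
    RCLike.continuous_conj.measurable (integrable_conj_inner_mul_inner x)]
  simp_rw [RCLike.conj_mul, ← RCLike.ofReal_pow]
  rw [integral_ofReal]
  simp_rw [norm_inner_symm _ x]
  rw [integral_norm_inner_sq_gaussian hx]
  simp

theorem integral_sesq {Ω : Type*} [MeasurableSpace Ω] {μ : Measure Ω}
    (A : Matrix (Fin n) (Fin n) 𝕜) {F : Type*} [NormedAddCommGroup F] [InnerProductSpace 𝕜 F]
    {s u : Ω → Fin n → 𝕜} {x : Fin n → F} {k : 𝕜}
    (hi : ∀ i j, Integrable (fun g => inner 𝕜 (s g i) (u g j)) μ)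
    (hk : ∀ i j, ∫ g, inner 𝕜 (s g i) (u g j) ∂μ = k * inner 𝕜 (x i) (x j)) :
    Integrable (fun g => sesq A (s g) (u g)) μ ∧ ∫ g, sesq A (s g) (u g) ∂μ = k * sesq A x x := by
  have h : ∀ i j, Integrable (fun g => A i j * inner 𝕜 (s g i) (u g j)) μ :=
    fun i j => (hi i j).const_mul _
  have h' : ∀ i, Integrable (fun g => ∑ j, A i j * inner 𝕜 (s g i) (u g j)) μ :=
    fun i => integrable_finsetSum _ fun j _ => h i j
  refine ⟨integrable_finsetSum _ fun i _ => h' i, ?_⟩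
  unfold sesq
  rw [integral_finsetSum _ fun i _ => h' i, Finset.mul_sum]
  refine Finset.sum_congr rfl fun i _ => ?_
  rw [integral_finsetSum _ fun j _ => h i j, Finset.mul_sum]
  refine Finset.sum_congr rfl fun j _ => ?_
  rw [integral_const_mul, hk]
  ring

theorem le_thetaSeminorm (A : Matrix (Fin n) (Fin n) 𝕜) {δ : Fin n → 𝕜} (hδ : ∀ i, ‖δ i‖ = 1) :
    ‖sesq A δ δ‖ ≤ thetaSeminorm n A := by
  refine (thetaSeminorm_isGreatest A).2 ⟨δ, hδ, ?_⟩
  simp [quadScalarVal, sesq, mul_comm]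

theorem sesq_sphere_le_thetaSeminorm {A : Matrix (Fin n) (Fin n) 𝕜} (hA : A.PosSemidef)
    {x : Fin n → E} (hx : ∀ i, ‖x i‖ = 1) :
    gaussianAbs 𝕜 ^ 2 / Module.finrank ℝ 𝕜 * RCLike.re (sesq A x x) ≤ thetaSeminorm n A := by
  have he : (0 : ℝ) < Module.finrank ℝ 𝕜 := by exact_mod_cast finrank_real_pos 𝕜
  -- This `l` maximizes `2lc - l²e`; the maximum is `c²/e`.
  set l : ℝ := gaussianAbs 𝕜 / Module.finrank ℝ 𝕜 with hl
  let u : E → Fin n → 𝕜 := fun g i => inner 𝕜 g (x i)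
  let s : E → Fin n → 𝕜 := fun g i => phase (u g i)
  obtain ⟨hSU, hSU'⟩ : Integrable (fun g => sesq A (s g) (u g)) (gaussian 𝕜 E) ∧
      ∫ g, sesq A (s g) (u g) ∂gaussian 𝕜 E = gaussianAbs 𝕜 * sesq A x x := by
    refine integral_sesq A (fun i j => ?_) fun i j => ?_
    · simp only [RCLike.inner_apply, mul_comm (u _ j)]
      exact integrable_conj_phase_mul_inner (x i) (x j)
    · simp only [RCLike.inner_apply, mul_comm (u _ j)]
      exact integral_conj_phase_mul_inner (hx i) (x j)
  obtain ⟨hUU, hUU'⟩ : Integrable (fun g => sesq A (u g) (u g)) (gaussian 𝕜 E) ∧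
      ∫ g, sesq A (u g) (u g) ∂gaussian 𝕜 E = Module.finrank ℝ 𝕜 * sesq A x x := by
    refine integral_sesq A (fun i j => ?_) fun i j => ?_
    · simp only [RCLike.inner_apply, mul_comm (u _ j)]
      exact integrable_conj_inner_mul_inner (x i) (x j)
    · simp only [RCLike.inner_apply, mul_comm (u _ j)]
      exact integral_conj_inner_mul_inner (hx i) (x j)
  -- Expand positivity at `s - l u` and bound the term in `s` alone by `‖A‖_θ`.
  have hpt : ∀ g, 2 * l * RCLike.re (sesq A (s g) (u g)) - l ^ 2 * RCLike.re (sesq A (u g) (u g)) ≤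
      thetaSeminorm n A := by
    intro g
    have h1 := (RCLike.nonneg_iff.1 (sesq_self_nonneg hA (s g - (l : 𝕜) • u g))).1
    rw [sesq_sub_sub, ← star_sesq hA.1 (s g) ((l : 𝕜) • u g), sesq_smul_right A _ (s g),
      sesq_smul_right, sesq_smul_left] at h1
    have h2 := (RCLike.re_le_norm _).trans (le_thetaSeminorm A (δ := s g) fun i => norm_phase _)
    simp at h1
    nlinarith
  have hint := integral_mono ((hSU.re.const_mul (2 * l)).sub (hUU.re.const_mul (l ^ 2)))
    (integrable_const (thetaSeminorm n A)) hpt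
  rw [integral_sub' (hSU.re.const_mul (2 * l)) (hUU.re.const_mul (l ^ 2)), integral_const_mul,
    integral_const_mul, integral_re hSU, integral_re hUU, hSU', hUU'] at hint
  simp only [integral_const, probReal_univ, one_smul, RCLike.re_ofReal_mul] at hint
  have hcast : RCLike.re ((Module.finrank ℝ 𝕜 : 𝕜) * sesq A x x) =
      Module.finrank ℝ 𝕜 * RCLike.re (sesq A x x) := by
    rw [← RCLike.ofReal_natCast, RCLike.re_ofReal_mul]
  rw [hcast] at hint
  refine le_trans (le_of_eq ?_) hint
  rw [hl]
  field_simp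
  ring

end Rounding

/-! ### The upper bound for all nine pairs of norms -/

section UpperBound

variable {𝕜 : Type*} [RCLike 𝕜] {n : ℕ} {E F : Type*} [NormedAddCommGroup E]
  [InnerProductSpace 𝕜 E] [NormedAddCommGroup F] [InnerProductSpace 𝕜 F]

variable (𝕜) in
/-- The constant `e / 𝔼|g|²`, where `g` is a standard Gaussian scalar and `e = 𝔼[|g|²]` is the real
dimension of `𝕜`. -/
noncomputable def psdConstant : ℝ := Module.finrank ℝ 𝕜 / gaussianAbs 𝕜 ^ 2

theorem psdConstant_pos : 0 < psdConstant 𝕜 := by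
  have he : (0 : ℝ) < Module.finrank ℝ 𝕜 := by exact_mod_cast finrank_real_pos 𝕜
  have := gaussianAbs_pos 𝕜
  unfold psdConstant
  positivity

theorem norm_eq_of_inner_self_eq {x : E} {y : F} (h : inner 𝕜 y y = inner 𝕜 x x) :
    ‖y‖ = ‖x‖ := by
  rw [@norm_eq_sqrt_re_inner 𝕜, @norm_eq_sqrt_re_inner 𝕜 _ _ _ _ x, h]

theorem sesq_ball_le_thetaSeminorm {A : Matrix (Fin n) (Fin n) 𝕜} (hA : A.PosSemidef)
    {x : Fin n → E} (hx : ∀ i, ‖x i‖ ≤ 1) :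
    RCLike.re (sesq A x x) ≤ psdConstant 𝕜 * thetaSeminorm n A := by
  -- Padding in an orthogonal summand lifts each `x i` to the unit sphere and adds `sesq A w w ≥ 0`,
  -- so the value can only grow.
  let w : Fin n → EuclideanSpace 𝕜 (Fin n) :=
    fun i => ((√(1 - ‖x i‖ ^ 2) : ℝ) : 𝕜) • EuclideanSpace.single i 1
  let x' : Fin n → WithLp 2 (E × EuclideanSpace 𝕜 (Fin n)) := fun i => WithLp.toLp 2 (x i, w i)
  obtain ⟨y, hy⟩ := exists_euclidean_inner_eq (𝕜 := 𝕜) x' le_rfl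
  have hw : ∀ i, ‖w i‖ ^ 2 = 1 - ‖x i‖ ^ 2 := fun i => by
    have h0 : 0 ≤ 1 - ‖x i‖ ^ 2 := by nlinarith [hx i, norm_nonneg (x i)]
    simp [w, norm_smul, Real.sq_sqrt h0]
  have hy1 : ∀ i, ‖y i‖ = 1 := fun i => by
    rw [norm_eq_of_inner_self_eq (hy i i), ← sq_eq_sq₀ (norm_nonneg _) zero_le_one,
      WithLp.prod_norm_sq_eq_of_L2]
    simp [x', hw]
  have h1 : sesq A y y = sesq A x x + sesq A w w := by
    rw [sesq_congr hy]
    simp [sesq, x', WithLp.prod_inner_apply, mul_add, Finset.sum_add_distrib]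
  have h2 := sesq_sphere_le_thetaSeminorm hA hy1
  have h3 := (RCLike.nonneg_iff.1 (sesq_self_nonneg hA w)).1
  have he : (0 : ℝ) < Module.finrank ℝ 𝕜 := by exact_mod_cast finrank_real_pos 𝕜
  have hc := gaussianAbs_pos 𝕜
  rw [h1, map_add, div_mul_eq_mul_div, div_le_iff₀ he] at h2
  rw [psdConstant, div_mul_eq_mul_div, le_div_iff₀ (by positivity)]
  have hc2 : 0 < gaussianAbs 𝕜 ^ 2 := by positivity
  nlinarith

/-- For a positive form, a mixed value is at most the mean of two diagonal values, each already
controlled on the ball. -/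
theorem gNorm_le_psdConstant_mul_thetaSeminorm {A : Matrix (Fin n) (Fin n) 𝕜}
    (hA : A.PosSemidef) : gNorm n n A ≤ psdConstant 𝕜 * thetaSeminorm n A := by
  obtain ⟨x, y, hx, hy, h⟩ := (gNorm_isGreatest A).1
  have h1 := two_mul_norm_sesq_le hA x y
  have h2 := sesq_ball_le_thetaSeminorm hA hx
  have h3 := sesq_ball_le_thetaSeminorm hA hy
  have h4 : bilinVal A x y = ‖sesq A x y‖ := rfl
  rw [h, h4]
  linarith

theorem gammaSeminorm_le_capGammaNorm (A : Matrix (Fin n) (Fin n) 𝕜) :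
    gammaSeminorm n A ≤ capGammaNorm n A := by
  obtain ⟨x, hx, h⟩ := (gammaSeminorm_isGreatest A).1
  exact (capGammaNorm_isGreatest A).2 ⟨x, fun i => (hx i).le, h⟩

theorem capGammaNorm_le_gNorm (A : Matrix (Fin n) (Fin n) 𝕜) :
    capGammaNorm n A ≤ gNorm n n A := by
  obtain ⟨x, hx, h⟩ := (capGammaNorm_isGreatest A).1
  obtain ⟨y, hy⟩ := exists_euclidean_inner_eq (𝕜 := 𝕜) x (Nat.le_add_right n n)
  have hy1 : ∀ i, ‖y i‖ ≤ 1 := fun i => (norm_eq_of_inner_self_eq (hy i i)).trans_le (hx i)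
  refine (gNorm_isGreatest A).2 ⟨y, y, hy1, hy1, h.trans ?_⟩
  exact congrArg norm (sesq_congr hy).symm

theorem thetaSeminorm_le_capThetaNorm (A : Matrix (Fin n) (Fin n) 𝕜) :
    thetaSeminorm n A ≤ capThetaNorm n A := by
  obtain ⟨x, hx, h⟩ := (thetaSeminorm_isGreatest A).1
  exact (capThetaNorm_isGreatest A).2 ⟨x, fun i => (hx i).le, h⟩

theorem capThetaNorm_le_inftyOneNorm (A : Matrix (Fin n) (Fin n) 𝕜) :
    capThetaNorm n A ≤ inftyOneNorm n n A := by
  obtain ⟨x, hx, h⟩ := (capThetaNorm_isGreatest A).1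
  exact (inftyOneNorm_isGreatest A).2 ⟨x, x, hx, hx, h⟩

theorem vectorNorms_bounds {N : ∀ n : ℕ, Matrix (Fin n) (Fin n) 𝕜 → ℝ} (hN : N ∈ vectorNorms 𝕜)
    (A : Matrix (Fin n) (Fin n) 𝕜) : gammaSeminorm n A ≤ N n A ∧ N n A ≤ gNorm n n A := by
  have h1 := gammaSeminorm_le_capGammaNorm A
  have h2 := capGammaNorm_le_gNorm A
  rcases hN with rfl | rfl | rfl
  · exact ⟨le_rfl, h1.trans h2⟩
  · exact ⟨h1, h2⟩
  · exact ⟨h1.trans h2, le_rfl⟩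

theorem scalarNorms_bounds {M : ∀ n : ℕ, Matrix (Fin n) (Fin n) 𝕜 → ℝ} (hM : M ∈ scalarNorms 𝕜)
    (A : Matrix (Fin n) (Fin n) 𝕜) : thetaSeminorm n A ≤ M n A ∧ M n A ≤ inftyOneNorm n n A := by
  have h1 := thetaSeminorm_le_capThetaNorm A
  have h2 := capThetaNorm_le_inftyOneNorm A
  rcases hM with rfl | rfl | rfl
  · exact ⟨le_rfl, h1.trans h2⟩
  · exact ⟨h1, h2⟩
  · exact ⟨h1.trans h2, le_rfl⟩

theorem vectorNorm_le_psdConstant_mul_scalarNorm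
    {N M : ∀ n : ℕ, Matrix (Fin n) (Fin n) 𝕜 → ℝ} (hN : N ∈ vectorNorms 𝕜)
    (hM : M ∈ scalarNorms 𝕜) {A : Matrix (Fin n) (Fin n) 𝕜} (hA : A.PosSemidef) :
    N n A ≤ psdConstant 𝕜 * M n A :=
  ((vectorNorms_bounds hN A).2.trans (gNorm_le_psdConstant_mul_thetaSeminorm hA)).trans
    (mul_le_mul_of_nonneg_left (scalarNorms_bounds hM A).1 psdConstant_pos.le)

end UpperBound

/-! ### Gram matrices of discretized Gaussians -/

section LowerBound

open MeasureTheory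

variable {𝕜 : Type*} [RCLike 𝕜] {n d : ℕ}

/-- The frame inequality for weighted unit vectors in `𝕜ᵈ`. -/
theorem sq_sum_le_mul_sum_norm_inner_sq {x : Fin n → EuclideanSpace 𝕜 (Fin d)}
    (hx : ∀ i, ‖x i‖ = 1) (w : Fin n → ℝ) :
    (∑ i, w i) ^ 2 ≤ d * ∑ i, ∑ j, w i * w j * ‖inner 𝕜 (x i) (x j)‖ ^ 2 := by
  -- `M = ∑ wᵢ xᵢ xᵢ*` has trace `∑ wᵢ`, and the double sum is its squared Hilbert–Schmidt norm; the
  -- claim is `|tr M|² ≤ d‖M‖²`.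
  let M : Fin d → Fin d → 𝕜 := fun k l => ∑ i, w i * (x i k * (starRingEnd 𝕜) (x i l))
  have hM : ∑ i, ∑ j, w i * w j * ‖inner 𝕜 (x i) (x j)‖ ^ 2 = ∑ k, ∑ l, ‖M k l‖ ^ 2 := by
    rw [← RCLike.ofReal_inj (K := 𝕜)]
    push_cast
    have h1 : ∀ i j, ((w i : 𝕜) * w j * (‖inner 𝕜 (x i) (x j)‖ : 𝕜) ^ 2) =
        ∑ k, ∑ l, (w i * ((starRingEnd 𝕜) (x i k) * x i l)) *
          (w j * (x j k * (starRingEnd 𝕜) (x j l))) := by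
      intro i j
      rw [← RCLike.mul_conj, inner_conj_symm]
      simp only [PiLp.inner_apply, RCLike.inner_apply]
      rw [Finset.sum_mul_sum, Finset.mul_sum]
      refine Finset.sum_congr rfl fun k _ => ?_
      rw [Finset.mul_sum]
      exact Finset.sum_congr rfl fun l _ => by ring
    have h2 : ∀ k l, (‖M k l‖ : 𝕜) ^ 2 =
        ∑ i, ∑ j, (w i * ((starRingEnd 𝕜) (x i k) * x i l)) *
          (w j * (x j k * (starRingEnd 𝕜) (x j l))) := by
      intro k l
      rw [← RCLike.conj_mul, map_sum, Finset.sum_mul_sum]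
      simp only [map_mul, RCLike.conj_ofReal, RCLike.conj_conj]
    simp only [h1, h2]
    rw [Finset.sum_congr rfl fun i _ => Finset.sum_comm, Finset.sum_comm]
    refine Finset.sum_congr rfl fun k _ => ?_
    rw [Finset.sum_congr rfl fun i _ => Finset.sum_comm, Finset.sum_comm]
  have htr : ∑ k, M k k = ((∑ i, w i : ℝ) : 𝕜) := by
    simp only [M]
    rw [Finset.sum_comm]
    push_cast
    refine Finset.sum_congr rfl fun i _ => ?_
    rw [← Finset.mul_sum]
    have : ∑ k, x i k * (starRingEnd 𝕜) (x i k) = inner 𝕜 (x i) (x i) := by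
      simp only [PiLp.inner_apply, RCLike.inner_apply]
    rw [this, inner_self_eq_norm_sq_to_K, hx]
    simp
  have h3 : |∑ i, w i| ≤ ∑ k, ‖M k k‖ := by
    rw [← RCLike.norm_ofReal (K := 𝕜), ← htr]
    exact norm_sum_le _ _
  rw [hM, ← sq_abs]
  calc |∑ i, w i| ^ 2 ≤ (∑ k, ‖M k k‖) ^ 2 := by gcongr
    _ ≤ d * ∑ k, ‖M k k‖ ^ 2 := by
        simpa using sq_sum_le_card_mul_sum_sq (s := Finset.univ) (f := fun k => ‖M k k‖)
    _ ≤ d * ∑ k, ∑ l, ‖M k l‖ ^ 2 := by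
        gcongr with k _
        exact Finset.single_le_sum (f := fun l => ‖M k l‖ ^ 2) (fun l _ => by positivity)
          (Finset.mem_univ k)

/-- The transposed Gram matrix of `h₁, …, hₙ`. -/
noncomputable def cogram (h : Fin n → EuclideanSpace 𝕜 (Fin d)) : Matrix (Fin n) (Fin n) 𝕜 :=
  (Matrix.gram 𝕜 h).transpose

theorem cogram_posSemidef (h : Fin n → EuclideanSpace 𝕜 (Fin d)) : (cogram h).PosSemidef :=
  (Matrix.posSemidef_gram 𝕜 h).transpose

/-- Duality: the sum is tested against itself. -/
theorem norm_sum_smul_le {E : Type*} [NormedAddCommGroup E] [InnerProductSpace 𝕜 E]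
    {h : Fin n → E} {B : ℝ} (hB0 : 0 ≤ B) (hB : ∀ w, ∑ i, ‖inner 𝕜 w (h i)‖ ≤ B * ‖w‖) {δ : Fin n → 𝕜}
    (hδ : ∀ i, ‖δ i‖ ≤ 1) : ‖∑ i, δ i • h i‖ ≤ B := by
  set P := ∑ i, δ i • h i with hP
  rcases (norm_nonneg P).eq_or_lt with h0 | h0
  · rwa [← h0]
  · refine le_of_mul_le_mul_right ?_ h0
    rw [← sq]
    calc ‖P‖ ^ 2 = ‖inner 𝕜 P P‖ := by
          rw [inner_self_eq_norm_sq_to_K]; simp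
      _ = ‖∑ i, δ i * inner 𝕜 P (h i)‖ := by
          conv_lhs => rw [hP, inner_sum]
          simp only [inner_smul_right, hP]
      _ ≤ ∑ i, ‖inner 𝕜 P (h i)‖ := (norm_sum_le _ _).trans
          (Finset.sum_le_sum fun i _ => by
            rw [norm_mul]; exact mul_le_of_le_one_left (norm_nonneg _) (hδ i))
      _ ≤ B * ‖P‖ := hB P

/-- The form of a Gram matrix is the inner product of two combinations of the `h i` with
coefficients in the unit disc, each of norm at most `B`. -/
theorem inftyOneNorm_cogram_le {h : Fin n → EuclideanSpace 𝕜 (Fin d)} {B : ℝ}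
    (hB0 : 0 ≤ B) (hB : ∀ w, ∑ i, ‖inner 𝕜 w (h i)‖ ≤ B * ‖w‖) :
    inftyOneNorm n n (cogram h) ≤ B ^ 2 := by
  obtain ⟨ε, δ, hε, hδ, hr⟩ := (inftyOneNorm_isGreatest (cogram h)).1
  have hs : ∑ i, ∑ j, cogram h i j * (star (ε i) * δ j) =
      inner 𝕜 (∑ j, star (δ j) • h j) (∑ i, star (ε i) • h i) := by
    rw [sum_inner, Finset.sum_comm]
    refine Finset.sum_congr rfl fun j _ => ?_
    rw [inner_sum]
    refine Finset.sum_congr rfl fun i _ => ?_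
    simp only [inner_smul_left, inner_smul_right, cogram, Matrix.transpose_apply,
      Matrix.gram_apply, starRingEnd_apply, star_star]
    ring
  rw [hr, bilinScalarVal, hs]
  have h1 := norm_sum_smul_le hB0 hB (δ := fun j => star (δ j)) (by simpa using hδ)
  have h2 := norm_sum_smul_le hB0 hB (δ := fun j => star (ε j)) (by simpa using hε)
  refine (norm_inner_le_norm _ _).trans ?_
  rw [sq]
  exact mul_le_mul h1 h2 (norm_nonneg _) ((norm_nonneg _).trans h1)

/-- The directions of the `h i` serve as test vectors, and the frame inequality with weights `‖h i‖`
bounds their value. -/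
theorem sq_sum_norm_le_mul_gammaSeminorm_cogram (hd : 0 < d)
    (h : Fin n → EuclideanSpace 𝕜 (Fin d)) :
    (∑ i, ‖h i‖) ^ 2 ≤ d * gammaSeminorm n (cogram h) := by
  let x : Fin n → EuclideanSpace 𝕜 (Fin d) := fun i =>
    -- A zero vector has weight `0`, so any unit vector will do; its existence requires `0 < d`.
    if h i = 0 then EuclideanSpace.single ⟨0, hd⟩ 1 else ((‖h i‖ : 𝕜)⁻¹) • h i
  have hx : ∀ i, ‖x i‖ = 1 := fun i => by
    simp only [x]
    split_ifs with h0
    · simp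
    · rw [norm_smul, norm_inv, RCLike.norm_ofReal, abs_norm, inv_mul_cancel₀ (by simpa using h0)]
  have hhx : ∀ i, h i = (‖h i‖ : 𝕜) • x i := fun i => by
    simp only [x]
    split_ifs with h0
    · simp [h0]
    · rw [smul_smul, mul_inv_cancel₀ (by simpa using h0), one_smul]
  refine (sq_sum_le_mul_sum_norm_inner_sq hx fun i => ‖h i‖).trans ?_
  gcongr
  obtain ⟨y, hy⟩ := exists_euclidean_inner_eq (𝕜 := 𝕜) x le_rfl
  refine le_trans ?_ ((gammaSeminorm_isGreatest (cogram h)).2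
    ⟨y, fun i => (norm_eq_of_inner_self_eq (hy i i)).trans (hx i), rfl⟩)
  -- The transpose pairs `⟨xⱼ, xᵢ⟩` with `⟨xᵢ, xⱼ⟩`, producing squared moduli; the untransposed Gram
  -- matrix would give complex squares.
  have h1 : ∑ i, ∑ j, cogram h i j * inner 𝕜 (y i) (y j) =
      ((∑ i, ∑ j, ‖h i‖ * ‖h j‖ * ‖inner 𝕜 (x i) (x j)‖ ^ 2 : ℝ) : 𝕜) := by
    push_cast
    refine Finset.sum_congr rfl fun i _ => Finset.sum_congr rfl fun j _ => ?_
    rw [hy, ← RCLike.mul_conj, inner_conj_symm]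
    have h2 : cogram h i j = (‖h i‖ : 𝕜) * ‖h j‖ * inner 𝕜 (x j) (x i) := by
      rw [cogram, Matrix.transpose_apply, Matrix.gram_apply]
      conv_lhs => rw [hhx i, hhx j]
      rw [inner_smul_left, inner_smul_right, RCLike.conj_ofReal]
      ring
    rw [h2]
    ring
  rw [quadVal, h1, RCLike.norm_ofReal]
  exact le_abs_self _

/-- The Gaussian measure is approximated in mean by finitely many vectors. -/
theorem exists_discretization {E : Type*} [NormedAddCommGroup E] [InnerProductSpace 𝕜 E]
    [FiniteDimensional 𝕜 E] [MeasurableSpace E] [BorelSpace E] {ε : ℝ} (hε : 0 < ε) :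
    ∃ (n : ℕ) (h : Fin n → E), ∫ g, ‖g‖ ∂gaussian 𝕜 E - ε ≤ ∑ i, ‖h i‖ ∧
      ∀ w : E, ∑ i, ‖inner 𝕜 w (h i)‖ ≤ (gaussianAbs 𝕜 + ε) * ‖w‖ := by
  have : SecondCountableTopology E := by
    have := FiniteDimensional.proper_rclike 𝕜 E
    infer_instance
  have hn : Integrable (fun g : E => ‖g‖) (gaussian 𝕜 E) := by
    simpa using integrable_norm_pow_gaussian 𝕜 (E := E) 1
  have hid : MemLp (fun g : E => g) 1 (gaussian 𝕜 E) :=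
    memLp_one_iff_integrable.2 ((integrable_norm_iff (by fun_prop)).1 hn)
  obtain ⟨s, hs, hsm⟩ := hid.exists_simpleFunc_eLpNorm_sub_lt (by simp)
    (ε := ENNReal.ofReal ε) (by simpa using hε)
  have hsi : Integrable s (gaussian 𝕜 E) := memLp_one_iff_integrable.1 hsm
  have hdi : Integrable (fun g : E => ‖g - s g‖) (gaussian 𝕜 E) :=
    ((memLp_one_iff_integrable.1 hid).sub hsi).norm
  have hdε : ∫ g : E, ‖g - s g‖ ∂gaussian 𝕜 E ≤ ε := by
    have h1 := integral_norm_eq_lintegral_enorm (μ := gaussian 𝕜 E)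
      ((memLp_one_iff_integrable.1 hid).sub hsi).1
    rw [← eLpNorm_one_eq_lintegral_enorm] at h1
    refine (le_of_eq h1).trans (ENNReal.toReal_le_of_le_ofReal hε.le hs.le)
  -- Each value of the approximating simple function is scaled by its probability, so sums of
  -- positively homogeneous functions become integrals over `s`.
  let k : E → E := fun v => (((gaussian 𝕜 E).real (s ⁻¹' {v}) : ℝ) : 𝕜) • v
  have hsum : ∀ f : E → ℝ, f 0 = 0 → (∀ (r : ℝ) (v : E), 0 ≤ r → f ((r : 𝕜) • v) = r * f v) →
      ∑ i : Fin s.range.card, f (k (s.range.equivFin.symm i)) = ∫ g, f (s g) ∂gaussian 𝕜 E := by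
    intro f hf0 hf
    rw [s.range.equivFin.symm.sum_comp (fun v : s.range => f (k v)),
      Finset.sum_coe_sort s.range (fun v => f (k v))]
    have h1 := SimpleFunc.map_integral s f hsi hf0
    rw [SimpleFunc.integral_eq_integral _ (SimpleFunc.integrable_of_isFiniteMeasure _)] at h1
    simp only [SimpleFunc.coe_map, Function.comp_def] at h1
    rw [h1]
    refine Finset.sum_congr rfl fun v _ => ?_
    rw [hf _ _ measureReal_nonneg, smul_eq_mul]
  refine ⟨s.range.card, fun i => k (s.range.equivFin.symm i), ?_, fun w => ?_⟩
  · rw [hsum (fun v => ‖v‖) (by simp) fun r v hr => by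
      rw [norm_smul, RCLike.norm_ofReal, abs_of_nonneg hr]]
    have h1 := integral_mono hn (hdi.add hsi.norm) fun g => by
      have := norm_add_le (g - s g) (s g)
      simpa using this
    rw [integral_add' hdi hsi.norm] at h1
    linarith
  · rw [hsum (fun v => ‖inner 𝕜 w v‖) (by simp) fun r v hr => by
      rw [inner_smul_right, norm_mul, RCLike.norm_ofReal, abs_of_nonneg hr]]
    rcases eq_or_ne w 0 with rfl | hw
    · simp
    have hw0 : (‖w‖ : 𝕜) ≠ 0 := by simpa using hw
    have hu : ‖((‖w‖ : 𝕜)⁻¹) • w‖ = 1 := by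
      rw [norm_smul, norm_inv, RCLike.norm_ofReal, abs_norm, inv_mul_cancel₀ (by simpa using hw)]
    have hI : Integrable (fun g => ‖inner 𝕜 w g‖) (gaussian 𝕜 E) := by
      simpa only [norm_inner_symm] using (integrable_inner_gaussian (𝕜 := 𝕜) w).norm
    have hw1 : ∫ g, ‖inner 𝕜 w g‖ ∂gaussian 𝕜 E = ‖w‖ * gaussianAbs 𝕜 := by
      rw [← integral_norm_inner_gaussian hu, ← integral_const_mul]
      refine integral_congr_ae (ae_of_all _ fun g => ?_)
      simp only [inner_smul_left, norm_mul, RCLike.norm_conj, norm_inv, RCLike.norm_ofReal,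
        abs_norm]
      rw [mul_inv_cancel_left₀ (by simpa using hw)]
    have h1 := integral_mono_of_nonneg (ae_of_all _ fun g : E => norm_nonneg (inner 𝕜 w (s g)))
      (hI.add (hdi.const_mul ‖w‖)) (ae_of_all (gaussian 𝕜 E) fun g => by
        have h2 : inner 𝕜 w (s g) = inner 𝕜 w g - inner 𝕜 w (g - s g) := by
          rw [← inner_sub_right, sub_sub_cancel]
        have h3 := norm_sub_le (inner 𝕜 w g) (inner 𝕜 w (g - s g))
        have h4 := norm_inner_le_norm (𝕜 := 𝕜) w (g - s g)
        simp only [Pi.add_apply]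
        rw [h2]
        linarith)
    rw [integral_add' hI (hdi.const_mul ‖w‖), integral_const_mul, hw1] at h1
    nlinarith [norm_nonneg w]

end LowerBound

/-! ### Passage to the limit and the values of the constants -/

section Sharpness

open MeasureTheory Filter Topology

variable {𝕜 : Type*} [RCLike 𝕜]

/-- Discretizing the Gaussian kernel on `𝕜ᵈ` bounds every upper bound of the quotients from
below. -/
theorem discretization_le_of_mem_upperBounds {N M : ∀ n : ℕ, Matrix (Fin n) (Fin n) 𝕜 → ℝ}
    (hN : N ∈ vectorNorms 𝕜) (hM : M ∈ scalarNorms 𝕜) {b : ℝ}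
    (hb : b ∈ upperBounds {r : ℝ | ∃ (n : ℕ) (A : Matrix (Fin n) (Fin n) 𝕜),
      A ∈ psdCone 𝕜 n ∧ M n A ≠ 0 ∧ r = N n A / M n A}) {d : ℕ} (hd : 0 < d) {ε : ℝ}
    (hε : 0 < ε) (hε' : ε < ∫ g, ‖g‖ ∂gaussian 𝕜 (EuclideanSpace 𝕜 (Fin d))) :
    (∫ g, ‖g‖ ∂gaussian 𝕜 (EuclideanSpace 𝕜 (Fin d)) - ε) ^ 2 ≤
      d * (b * (gaussianAbs 𝕜 + ε) ^ 2) := by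
  obtain ⟨n, h, h1, h2⟩ := exists_discretization (𝕜 := 𝕜) (E := EuclideanSpace 𝕜 (Fin d)) hε
  have hc := gaussianAbs_pos 𝕜
  have hpsd := cogram_posSemidef h
  have hγ := sq_sum_norm_le_mul_gammaSeminorm_cogram hd h
  have hι := inftyOneNorm_cogram_le (add_pos hc hε).le h2
  have hNA := (vectorNorms_bounds hN (cogram h)).1
  have hMA := (scalarNorms_bounds hM (cogram h)).2
  have hNM := vectorNorm_le_psdConstant_mul_scalarNorm hN hM hpsd
  have hd' : (0 : ℝ) < d := by exact_mod_cast hd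
  have h3 : (∫ g, ‖g‖ ∂gaussian 𝕜 (EuclideanSpace 𝕜 (Fin d)) - ε) ^ 2 ≤ (∑ i, ‖h i‖) ^ 2 :=
    pow_le_pow_left₀ (by linarith) h1 2
  have h4 : 0 < (∫ g, ‖g‖ ∂gaussian 𝕜 (EuclideanSpace 𝕜 (Fin d)) - ε) ^ 2 :=
    pow_pos (by linarith) 2
  have hNpos : 0 < N n (cogram h) :=
    (pos_of_mul_pos_right (h4.trans_le (h3.trans hγ)) hd'.le).trans_le hNA
  -- The upper bound already proved shows that the denominator does not vanish.
  have hMpos : 0 < M n (cogram h) :=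
    pos_of_mul_pos_right (hNpos.trans_le hNM) psdConstant_pos.le
  have hbNM : N n (cogram h) / M n (cogram h) ≤ b := hb ⟨n, cogram h, hpsd, hMpos.ne', rfl⟩
  have hbpos : 0 < b := (div_pos hNpos hMpos).trans_le hbNM
  refine h3.trans (hγ.trans (mul_le_mul_of_nonneg_left ?_ hd'.le))
  refine hNA.trans (((div_le_iff₀ hMpos).1 hbNM).trans ?_)
  exact mul_le_mul_of_nonneg_left (hMA.trans hι) hbpos.le

/-- For fixed `d` the discretization error tends to `0`; then `d → ∞` removes the factor `(1 -
1/(ed))²`. -/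
theorem psdConstant_le_of_mem_upperBounds {N M : ∀ n : ℕ, Matrix (Fin n) (Fin n) 𝕜 → ℝ}
    (hN : N ∈ vectorNorms 𝕜) (hM : M ∈ scalarNorms 𝕜) {b : ℝ}
    (hb : b ∈ upperBounds {r : ℝ | ∃ (n : ℕ) (A : Matrix (Fin n) (Fin n) 𝕜),
      A ∈ psdCone 𝕜 n ∧ M n A ≠ 0 ∧ r = N n A / M n A}) : psdConstant 𝕜 ≤ b := by
  set e : ℝ := (Module.finrank ℝ 𝕜 : ℝ) with he_def
  have he1 : 1 ≤ e := Nat.one_le_cast.2 (finrank_real_pos 𝕜)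
  have he : 0 < e := one_pos.trans_le he1
  have hc := gaussianAbs_pos 𝕜
  -- With `2 ≤ d` the factor `1 - 1/(ed)` is positive even for `e = 1`, so the lower bound on the
  -- mean norm may be squared.
  have key : ∀ d : ℕ, 2 ≤ d → e * (1 - 1 / (e * d)) ^ 2 ≤ b * gaussianAbs 𝕜 ^ 2 := by
    intro d hd
    have hd0 : 0 < d := by omega
    have hd' : (2 : ℝ) ≤ d := by exact_mod_cast hd
    have : Nonempty (Fin d) := ⟨⟨0, hd0⟩⟩
    have hI := sqrt_mul_le_integral_norm_gaussian 𝕜 (E := EuclideanSpace 𝕜 (Fin d))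
    rw [finrank_euclideanSpace_fin, ← he_def] at hI
    set I := ∫ g, ‖g‖ ∂gaussian 𝕜 (EuclideanSpace 𝕜 (Fin d)) with hI_def
    have hed : 1 < e * d := by nlinarith
    have h1 : 0 < 1 - 1 / (e * d) := by
      rw [sub_pos, div_lt_one (by linarith)]
      exact hed
    have hlow : 0 < √(e * d) * (1 - 1 / (e * d)) :=
      mul_pos (Real.sqrt_pos.2 (by linarith)) h1
    have hIpos : 0 < I := hlow.trans_le hI
    have hlim : I ^ 2 ≤ d * (b * gaussianAbs 𝕜 ^ 2) := by
      have t1 : Tendsto (fun ε : ℝ => (I - ε) ^ 2) (𝓝[>] 0) (𝓝 ((I - 0) ^ 2)) :=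
        (Continuous.tendsto (by fun_prop) 0).mono_left nhdsWithin_le_nhds
      have t2 : Tendsto (fun ε : ℝ => d * (b * (gaussianAbs 𝕜 + ε) ^ 2)) (𝓝[>] 0)
          (𝓝 (d * (b * (gaussianAbs 𝕜 + 0) ^ 2))) :=
        (Continuous.tendsto (by fun_prop) 0).mono_left nhdsWithin_le_nhds
      rw [sub_zero] at t1
      rw [add_zero] at t2
      refine le_of_tendsto_of_tendsto t1 t2 ?_
      filter_upwards [Ioo_mem_nhdsGT hIpos] with ε hε
      exact discretization_le_of_mem_upperBounds hN hM hb hd0 hε.1 hε.2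
    have h2 := (pow_le_pow_left₀ hlow.le hI 2).trans hlim
    rw [mul_pow, Real.sq_sqrt (by linarith)] at h2
    refine le_of_mul_le_mul_left ?_ (show (0 : ℝ) < d by linarith)
    linarith
  have t : Tendsto (fun d : ℕ => e * (1 - 1 / (e * d)) ^ 2) atTop (𝓝 (e * (1 - 0) ^ 2)) := by
    refine Tendsto.const_mul _ (Tendsto.pow (Tendsto.sub tendsto_const_nhds ?_) 2)
    exact Tendsto.div_atTop tendsto_const_nhds
      (Tendsto.const_mul_atTop he tendsto_natCast_atTop_atTop)
  have h := le_of_tendsto t (eventually_atTop.2 ⟨2, key⟩)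
  rw [psdConstant, div_le_iff₀ (by positivity)]
  linarith

theorem isConicConstant_psdCone {N M : ∀ n : ℕ, Matrix (Fin n) (Fin n) 𝕜 → ℝ}
    (hN : N ∈ vectorNorms 𝕜) (hM : M ∈ scalarNorms 𝕜) :
    IsConicConstant (psdCone 𝕜) N M (psdConstant 𝕜) := by
  refine ⟨?_, fun b hb => psdConstant_le_of_mem_upperBounds hN hM hb⟩
  rintro r ⟨n, A, hA, hMA, rfl⟩
  have hθ : 0 ≤ thetaSeminorm n A := by
    obtain ⟨δ, -, h⟩ := (thetaSeminorm_isGreatest A).1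
    rw [h]
    exact norm_nonneg _
  have hMpos : 0 < M n A := lt_of_le_of_ne (hθ.trans (scalarNorms_bounds hM A).1) hMA.symm
  rw [div_le_iff₀ hMpos]
  exact vectorNorm_le_psdConstant_mul_scalarNorm hN hM hA

theorem psdConstant_real : psdConstant ℝ = Real.pi / 2 := by
  have h2 : ((2 : ℝ) ^ ((1 : ℝ) / 2)) ^ 2 = 2 := by
    rw [← Real.sqrt_eq_rpow, Real.sq_sqrt (by norm_num)]
  rw [psdConstant, gaussianAbs_eq, Module.finrank_self, div_pow, mul_pow, h2]
  norm_num [Real.Gamma_one, Real.Gamma_one_half_eq, Real.sq_sqrt Real.pi_pos.le]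

theorem psdConstant_complex : psdConstant ℂ = 4 / Real.pi := by
  have h2 : ((2 : ℝ) ^ ((1 : ℝ) / 2)) ^ 2 = 2 := by
    rw [← Real.sqrt_eq_rpow, Real.sq_sqrt (by norm_num)]
  have h3 : Real.Gamma (3 / 2) = √Real.pi / 2 := by
    rw [show (3 / 2 : ℝ) = 1 / 2 + 1 by norm_num, Real.Gamma_add_one (by norm_num),
      Real.Gamma_one_half_eq]
    ring
  rw [psdConstant, gaussianAbs_eq, Complex.finrank_real_complex, div_pow, mul_pow, h2]
  norm_num [Real.Gamma_one, h3, div_pow, Real.sq_sqrt Real.pi_pos.le]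
  field_simp

end Sharpness

end Grothendieck

theorem theorem5p1 :
    -- the inequalities over the real numbers
    (∀ N ∈ Grothendieck.vectorNorms ℝ, ∀ M ∈ Grothendieck.scalarNorms ℝ,
      ∀ (n : ℕ) (A : Matrix (Fin n) (Fin n) ℝ), A.PosSemidef →
        N n A ≤ Real.pi / 2 * M n A) ∧
    -- the inequalities over the complex numbers
    (∀ N ∈ Grothendieck.vectorNorms ℂ, ∀ M ∈ Grothendieck.scalarNorms ℂ,
      ∀ (n : ℕ) (A : Matrix (Fin n) (Fin n) ℂ), A.PosSemidef →
        N n A ≤ 4 / Real.pi * M n A) ∧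
    -- sharpness of both constants
    (∀ N ∈ Grothendieck.vectorNorms ℝ, ∀ M ∈ Grothendieck.scalarNorms ℝ,
      Grothendieck.IsConicConstant (Grothendieck.psdCone ℝ) N M (Real.pi / 2)) ∧
    (∀ N ∈ Grothendieck.vectorNorms ℂ, ∀ M ∈ Grothendieck.scalarNorms ℂ,
      Grothendieck.IsConicConstant (Grothendieck.psdCone ℂ) N M (4 / Real.pi)) := by
  open Grothendieck in
  refine ⟨fun N hN M hM n A hA => ?_, fun N hN M hM n A hA => ?_, fun N hN M hM => ?_,
    fun N hN M hM => ?_⟩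
  · exact psdConstant_real ▸ vectorNorm_le_psdConstant_mul_scalarNorm hN hM hA
  · exact psdConstant_complex ▸ vectorNorm_le_psdConstant_mul_scalarNorm hN hM hA
  · exact psdConstant_real ▸ isConicConstant_psdCone hN hM
  · exact psdConstant_complex ▸ isConicConstant_psdCone hN hM
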